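/- Let $N=\{1,\dots,n\}$ be a set of agents and $G$ a finite set of goods. Each agent $i$ has a weight $w_i>0$ and a valuation $v_i:2^G\to\mathbb{R}_{\ge 0}$ that is a matroid rank function: $v_i(\emptyset)=0$, $v_i(S\cup\{g\})-v_i(S)\in\{0,1\}$ for all $S\subseteq G$ and $g\in G$, and $v_i(S\cup\{g\})-v_i(S)\ge v_i(T\cup\{g\})-v_i(T)$ for all $S\subseteq T\subseteq G$ and $g\in G$. An allocation is a partition $X=(X_0,X_1,\dots,X_n)$ of $G$ (parts may be empty), where agent $i$ gets $X_i$ and $X_0$ is the set of unallocated goods. Put $v_0(S)=|S|$. For an allocation $X$, the exchange graph $\mathcal{G}(X)$ is the directed graph on $G$ with an edge from $g\in X_i$ to $g'$ (where $i\in N\cup\{0\}$) if $v_i((X_i\setminus\{g\})\cup\{g'\})=v_i(X_i)$. Let $F_i(X)=\{g\in G: v_i(X_i\cup\{g\})-v_i(X_i)=1\}$. Let $M$ be a real number with $M>\big(1+\frac{1}{v_i(S)}\big)^{w_i}$ for all $i\in N$ and $S\subseteq G$ with $v_i(S)>0$, and put $$\phi(X,i)=\begin{cases}\big(1+\frac{1}{v_i(X_i)}\big)^{w_i}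 & \text{if } v_i(X_i)>0,\\ M & \text{if } v_i(X_i)=0.\end{cases}$$ General Yankee Swap with gain function $\phi$ is the following algorithm. Start with $X=(G,\emptyset,\dots,\emptyset)$ and $U=N$. While $U\neq\emptyset$: let $i$ be the agent with the least index among the agents of $U$ that maximize $\phi(X,\cdot)$ over $U$. If $\mathcal{G}(X)$ contains a path from $F_i(X)$ to $X_0$, take any shortest such path $(g_1,\dots,g_t)$, and simultaneously give $g_1$ to $i$ and, for $1\le k<t$, give $g_{k+1}$ to the agent who held $g_k$. Otherwise, remove $i$ from $U$. When $U=\emptyset$, return $X$. Theorem. Whatever shortest paths are chosen, this algorithm terminates, and the allocation that it returns is a max weighted Nash welfare allocation: it minimizes the number of agents $i\in N$ with $v_i(X_i)=0$ among all allocations and, among all allocations attaining this minimum, it maximizes $\prod_{i\in N:\,v_i(X_i)>0}v_i(X_i)^{w_i}$. -/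

import Mathlib

namespace YankeeSwap

variable {n : ℕ} {G : Type*} [Fintype G] [DecidableEq G]

/-- Matroid rank functions (binary submodular valuations) on the bundles of goods. -/
structure IsMRF (f : Finset G → ℝ) : Prop where
  empty : f ∅ = 0
  marginal : ∀ (S : Finset G) (g : G), f (insert g S) - f S = 0 ∨ f (insert g S) - f S = 1
  submodular : ∀ (S T : Finset G) (g : G), S ⊆ T →
    f (insert g T) - f T ≤ f (insert g S) - f S

/-- An allocation, i.e. a partition `(X₀, X₁, …, Xₙ)` of the goods, given by the owner of each
good: `some i` for agent `i`, and `none` for an unallocated good (the dummy agent `0`). -/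
abbrev Allocation (n : ℕ) (G : Type*) := G → Option (Fin n)

/-- The bundle held by agent `a` (for `a = none`: the set `X₀` of unallocated goods). -/
def bundle (X : Allocation n G) (a : Option (Fin n)) : Finset G :=
  Finset.univ.filter fun g => X g = a

/-- The valuations extended to the dummy agent, whose valuation is the cardinality. -/
def extVal (v : Fin n → Finset G → ℝ) : Option (Fin n) → Finset G → ℝ
  | some i, S => v i S
  | none, S => (S.card : ℝ)

/-- The utility vector of an allocation. -/
def utility (v : Fin n → Finset G → ℝ) (X : Allocation n G) (i : Fin n) : ℝ :=
  v i (bundle X (some i))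

/-- Edges of the exchange graph: the owner of `g` can replace `g` by `g'` in their bundle
without changing the value of the bundle. -/
def ExchangeEdge (v : Fin n → Finset G → ℝ) (X : Allocation n G) (g g' : G) : Prop :=
  extVal v (X g) (insert g' ((bundle X (X g)).erase g)) = extVal v (X g) (bundle X (X g))

/-- The goods with marginal gain `1` for agent `i`. -/
def desired (v : Fin n → Finset G → ℝ) (X : Allocation n G) (i : Fin n) : Set G :=
  {g | v i (insert g (bundle X (some i))) - v i (bundle X (some i)) = 1}

/-- `p = (g₁, …, g_t)`, `t ≥ 1`, is a path in the exchange graph from the goods desired by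
agent `i` to the unallocated goods. -/
def IsPath (v : Fin n → Finset G → ℝ) (X : Allocation n G) (i : Fin n) (p : List G) : Prop :=
  p.IsChain (ExchangeEdge v X) ∧
    (∃ g ∈ p.head?, g ∈ desired v X i) ∧ (∃ g ∈ p.getLast?, g ∈ bundle X none)

/-- A path of the least possible length. -/
def IsShortestPath (v : Fin n → Finset G → ℝ) (X : Allocation n G) (i : Fin n)
    (p : List G) : Prop :=
  IsPath v X i p ∧ ∀ q, IsPath v X i q → p.length ≤ q.length

/-- Transfer of goods along the path `(g₁, …, g_t)`, with `g₁` going to `a`: each `g_{k+1}` is given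
to the agent who holds `g_k` in `X`, and `g₁` is given to `a`; all other goods stay in place. -/
def transfer (X : Allocation n G) : Option (Fin n) → List G → Allocation n G
  | _, [] => X
  | a, g :: p => Function.update (transfer X (X g) p) g a

/-- A state of the algorithm: the current allocation and the set `U` of agents still playing. -/
structure State (n : ℕ) (G : Type*) where
  alloc : Allocation n G
  active : Finset (Fin n)

/-- The initial state: all goods are unallocated, all agents are playing. -/
def initState (n : ℕ) (G : Type*) : State n G := ⟨fun _ => none, Finset.univ⟩

/-- Agent `i` is the agent with the least index among the playing agents of maximum gain. -/
def IsSelected {β : Type*} [LinearOrder β] (v : Fin n → Finset G → ℝ)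
    (φ : (Fin n → ℝ) → Fin n → β) (s : State n G) (i : Fin n) : Prop :=
  IsLeast {k | k ∈ s.active ∧
    ∀ l ∈ s.active, φ (utility v s.alloc) l ≤ φ (utility v s.alloc) k} i

/-- One iteration of the loop of General Yankee Swap with gain function `φ`. Any shortest path may
be used. No iteration is possible when no agent is playing. -/
inductive Step {β : Type*} [LinearOrder β] (v : Fin n → Finset G → ℝ)
    (φ : (Fin n → ℝ) → Fin n → β) : State n G → State n G → Prop
  | augment (s : State n G) (i : Fin n) (p : List G) (hi : IsSelected v φ s i)
      (hp : IsShortestPath v s.alloc i p) :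
      Step v φ s ⟨transfer s.alloc (some i) p, s.active⟩
  | remove (s : State n G) (i : Fin n) (hi : IsSelected v φ s i)
      (hp : ¬ ∃ p, IsPath v s.alloc i p) :
      Step v φ s ⟨s.alloc, s.active.erase i⟩

/-- The states that occur in the runs of General Yankee Swap. -/
def Reachable {β : Type*} [LinearOrder β] (v : Fin n → Finset G → ℝ)
    (φ : (Fin n → ℝ) → Fin n → β) (s : State n G) : Prop :=
  Relation.ReflTransGen (Step v φ) (initState n G) s

/-- General Yankee Swap with gain function `φ` computes an allocation with property `P`: it has no
infinite run, no run gets stuck before all agents have been removed, and whenever a run has removed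
all agents, the allocation it returns has property `P`. -/
def Computes {β : Type*} [LinearOrder β] (v : Fin n → Finset G → ℝ)
    (φ : (Fin n → ℝ) → Fin n → β) (P : Allocation n G → Prop) : Prop :=
  (¬ ∃ r : ℕ → State n G, r 0 = initState n G ∧ ∀ k, Step v φ (r k) (r (k + 1))) ∧
  (∀ s, Reachable v φ s → s.active.Nonempty → ∃ s', Step v φ s s') ∧
  (∀ s, Reachable v φ s → s.active = ∅ → P s.alloc)

/-- The gain function for weighted Nash welfare, as a function of the utility vector. -/
noncomputable def nashGain (w : Fin n → ℝ) (M : ℝ) (u : Fin n → ℝ) (i : Fin n) : ℝ :=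
  if 0 < u i then (1 + 1 / u i) ^ (w i) else M

/-- The agents with positive utility. -/
noncomputable def posAgents (v : Fin n → Finset G → ℝ) (X : Allocation n G) : Finset (Fin n) :=
  Finset.univ.filter fun i => 0 < utility v X i

/-- The agents with zero utility. -/
noncomputable def zeroAgents (v : Fin n → Finset G → ℝ) (X : Allocation n G) : Finset (Fin n) :=
  Finset.univ.filter fun i => utility v X i = 0

/-- Max weighted Nash welfare allocations: the number of agents with zero utility is minimum and,
subject to this, the product of `v_i(X_i) ^ w_i` over the agents with positive utility is maximum. -/
def IsMaxWeightedNash (v : Fin n → Finset G → ℝ) (w : Fin n → ℝ) (X : Allocation n G) : Prop :=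
  (∀ Y : Allocation n G, (zeroAgents v X).card ≤ (zeroAgents v Y).card) ∧
  (∀ Y : Allocation n G, (zeroAgents v Y).card = (zeroAgents v X).card →
    ∏ i ∈ posAgents v Y, utility v Y i ^ w i ≤ ∏ i ∈ posAgents v X, utility v X i ^ w i)

end YankeeSwap

/-! Bundles stay independent throughout a run, since a shortest path has no shortcuts
(`transfer_direct`), so utilities are bundle sizes and no agent ever loses utility. Each
augmentation allocates a good and each removal deactivates an agent, whence termination.

Optimality rests on a matroid-union bound. If no path exists for `i`, the set `R` of goods reachable
from those desired by `i` and the set `A` of `i` and the owners of `R` make `∑ j ∈ A, v j Rᶜ + |R|`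
equal to the joint utility of `A`, and no allocation exceeds this (`exists_tightCert_of_no_path`).
As bundles never shrink, such a certificate persists (`TightCert.persist`), and certificates are
closed under unions (`TightCert.union`). By greedy selection, each agent of `A` received its last
good at a gain at least that of `i`.

With concave objectives `w log k`, valued `-K` at `k = 0`, whose increments at `k > 0` are the
logarithms of the gains, these facts give global optimality (`sum_concave_le`). A large `K`
minimizes the number of zero agents; for a fixed number, the objective is the log of the product. -/

namespace YankeeSwap

/-! ### Matroid rank functions -/

section Rank

variable {G : Type*} [DecidableEq G] {f : Finset G → ℝ}

namespace IsMRF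

theorem le_insert (hf : IsMRF f) (S : Finset G) (g : G) : f S ≤ f (insert g S) := by
  rcases hf.marginal S g with h | h <;> linarith

theorem insert_le (hf : IsMRF f) (S : Finset G) (g : G) : f (insert g S) ≤ f S + 1 := by
  rcases hf.marginal S g with h | h <;> linarith

theorem le_union (hf : IsMRF f) (S T : Finset G) : f S ≤ f (S ∪ T) := by
  induction T using Finset.induction_on with
  | empty => simp
  | insert g T _ ih =>
    rw [Finset.union_insert]
    exact ih.trans (hf.le_insert _ _)

theorem mono (hf : IsMRF f) {S T : Finset G} (h : S ⊆ T) : f S ≤ f T := by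
  simpa [Finset.union_eq_right.2 h] using hf.le_union S T

theorem union_le_add_card (hf : IsMRF f) (S T : Finset G) : f (S ∪ T) ≤ f S + T.card := by
  induction T using Finset.induction_on with
  | empty => simp
  | insert g T hg ih =>
    rw [Finset.union_insert, Finset.card_insert_of_notMem hg]
    have := hf.insert_le (S ∪ T) g
    push_cast
    linarith

theorem le_card (hf : IsMRF f) (S : Finset G) : f S ≤ S.card := by
  simpa [hf.empty] using hf.union_le_add_card ∅ S

theorem union_sub_le (hf : IsMRF f) {S T : Finset G} (h : S ⊆ T) (U : Finset G) :
    f (T ∪ U) - f T ≤ f (S ∪ U) - f S := by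
  induction U using Finset.induction_on with
  | empty => simp
  | insert g U _ ih =>
    have := hf.submodular (S ∪ U) (T ∪ U) g (Finset.union_subset_union_left h)
    rw [Finset.union_insert, Finset.union_insert]
    linarith

theorem union_add_inter_le (hf : IsMRF f) (S T : Finset G) :
    f (S ∪ T) + f (S ∩ T) ≤ f S + f T := by
  have := hf.union_sub_le (Finset.inter_subset_left : S ∩ T ⊆ S) T
  rw [Finset.union_eq_right.2 (Finset.inter_subset_right : S ∩ T ⊆ T)] at this
  linarith

theorem exists_nat (hf : IsMRF f) (S : Finset G) : ∃ k : ℕ, f S = k := by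
  induction S using Finset.induction_on with
  | empty => exact ⟨0, by simp [hf.empty]⟩
  | insert g S _ ih =>
    obtain ⟨k, hk⟩ := ih
    rcases hf.marginal S g with h | h
    · exact ⟨k, by linarith⟩
    · exact ⟨k + 1, by push_cast; linarith⟩

theorem eq_card_of_subset (hf : IsMRF f) {S T : Finset G} (h : S ⊆ T) (hT : f T = T.card) :
    f S = S.card := by
  refine le_antisymm (hf.le_card S) ?_
  have h1 := hf.union_le_add_card S (T \ S)
  rw [Finset.union_sdiff_of_subset h] at h1
  have h2 : ((T \ S).card : ℝ) + S.card = T.card := by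
    exact_mod_cast Finset.card_sdiff_add_card_eq_card h
  linarith

theorem union_le_of_forall_insert_le (hf : IsMRF f) {S T : Finset G}
    (h : ∀ g ∈ T, f (insert g S) ≤ f S) : f (S ∪ T) ≤ f S := by
  induction T using Finset.induction_on with
  | empty => simp
  | insert g T _ ih =>
    have h1 := ih fun x hx => h x (Finset.mem_insert_of_mem hx)
    have h2 := h g (Finset.mem_insert_self g T)
    have h3 := hf.submodular S (S ∪ T) g Finset.subset_union_left
    rw [Finset.union_insert]
    linarith

theorem insert_erase_eq_or (hf : IsMRF f) {S : Finset G} (hS : f S = S.card) {x : G} (hx : x ∈ S)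
    (h : G) : f (insert h (S.erase x)) = f S ∨ f (insert h (S.erase x)) = f S - 1 := by
  have h1 := hf.eq_card_of_subset (S.erase_subset x) hS
  have h2 : ((S.erase x).card : ℝ) + 1 = S.card := by
    exact_mod_cast Finset.card_erase_add_one hx
  rcases hf.marginal (S.erase x) h with h3 | h3
  · right; linarith
  · left; linarith

/-- If `h` depends on `S.erase x` for every `x ∈ S ∩ R`, then it depends on `S \ R`. -/
theorem insert_sdiff_le (hf : IsMRF f) {S R : Finset G} {h : G} (hS : f S = S.card)
    (h0 : f (insert h S) ≤ f S)
    (h1 : ∀ x ∈ S, x ∈ R → f (insert h (S.erase x)) ≤ f S - 1) :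
    f (insert h (S \ R)) ≤ f (S \ R) := by
  -- Remove the goods of `K` one at a time. The sets `insert h (S \ K)` and `insert h (S.erase x)`
  -- have a union containing `S`, so submodularity makes the rank of their intersection drop by one.
  have key : ∀ K ⊆ S ∩ R, f (insert h (S \ K)) ≤ (S \ K).card := by
    intro K
    induction K using Finset.induction_on with
    | empty => intro _; simpa [← hS] using h0
    | insert x K hx ih =>
      intro hK
      have hxS : x ∈ S ∩ R := hK (Finset.mem_insert_self x K)
      rw [Finset.mem_inter] at hxS
      have h2 := ih ((Finset.subset_insert x K).trans hK)
      have h3 := h1 x hxS.1 hxS.2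
      have h4 := hf.union_add_inter_le (insert h (S \ K)) (insert h (S.erase x))
      have h5 : f S ≤ f (insert h (S \ K) ∪ insert h (S.erase x)) := by
        apply hf.mono
        intro z hz
        by_cases hzx : z = x
        · simp [hzx, hx, hxS.1]
        · simp [hz, hzx]
      have h6 : insert h (S \ K) ∩ insert h (S.erase x) = insert h (S \ insert x K) := by
        ext z; simp; tauto
      have h7 : ((S \ insert x K).card : ℝ) + 1 = (S \ K).card := by
        rw [Finset.sdiff_insert]
        exact_mod_cast Finset.card_erase_add_one (Finset.mem_sdiff.2 ⟨hxS.1, hx⟩)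
      rw [h6] at h4
      linarith
  have h2 := key (S ∩ R) subset_rfl
  rw [Finset.sdiff_inter_self_left] at h2
  rwa [hf.eq_card_of_subset Finset.sdiff_subset hS]

end IsMRF

end Rank

/-! ### Walks without shortcuts -/

section DirectWalk

variable {α : Type*}

/-- `p` is a walk from `S` in the relation `E` without shortcuts: only its first vertex lies in `S`
and each vertex is related to the next vertex but to no later one. -/
def IsDirect : Set α → (α → α → Prop) → List α → Prop
  | _, _, [] => True
  | S, E, g :: p => g ∈ S ∧ (∀ h ∈ p, h ∉ S) ∧ IsDirect {h | E g h} E p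

/-- `p` is a walk from `S` to `T` in the relation `E`. -/
def IsWalk (S T : Set α) (E : α → α → Prop) (p : List α) : Prop :=
  p.IsChain E ∧ (∃ g ∈ p.head?, g ∈ S) ∧ (∃ g ∈ p.getLast?, g ∈ T)

/-- A later vertex in `S` would start a strictly shorter walk. The tail is again minimal, now from
the successors of `g`, which is why `S` varies in the induction. -/
theorem IsWalk.isDirect_of_minimal {T : Set α} {E : α → α → Prop} (p : List α) :
    ∀ {S : Set α}, IsWalk S T E p → (∀ q, IsWalk S T E q → p.length ≤ q.length) →
      IsDirect S E p := by
  induction p with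
  | nil => intro S _ _; trivial
  | cons g p ih =>
    intro S hp hmin
    obtain ⟨hc, hS, hT⟩ := hp
    have hgS : g ∈ S := by simpa using hS
    refine ⟨hgS, ?_, ?_⟩
    · intro h hh hhS
      obtain ⟨l₁, l₂, rfl⟩ := List.append_of_mem hh
      have := hmin (h :: l₂) ⟨?_, by simpa using hhS, ?_⟩
      · simp at this; omega
      · exact (List.isChain_append.1 hc.tail).2.1
      · simpa [List.getLast?_cons, List.getLast?_append] using hT
    · cases p with
      | nil => trivial
      | cons g' p =>
        apply ih
        · refine ⟨hc.tail, ?_, by simpa using hT⟩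
          simpa using (List.isChain_cons_cons.1 hc).1
        · rintro q ⟨hq1, hq2, hq3⟩
          have := hmin (g :: q) ⟨?_, by simpa using hgS, ?_⟩
          · simpa using this
          · cases q with
            | nil => simp at hq2
            | cons a q => exact List.isChain_cons_cons.2 ⟨by simpa using hq2, hq1⟩
          · cases q with
            | nil => simp at hq2
            | cons a q => simpa using hq3

theorem IsDirect.congr {E E' : α → α → Prop} (p : List α) :
    ∀ {S S' : Set α}, (∀ h ∈ p, h ∈ S ↔ h ∈ S') →
      (∀ x ∈ p, ∀ h ∈ p.tail, E x h ↔ E' x h) → IsDirect S E p → IsDirect S' E' p := by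
  induction p with
  | nil => intro _ _ _ _ _; trivial
  | cons g p ih =>
    rintro S S' hS hE ⟨h1, h2, h3⟩
    refine ⟨(hS g (by simp)).1 h1, fun h hh => ?_, ?_⟩
    · rw [← hS h (by simp [hh])]
      exact h2 h hh
    · refine ih (fun h hh => hE g (by simp) h hh) (fun x hx h hh => ?_) h3
      exact hE x (by simp [hx]) h (List.mem_of_mem_tail hh)

end DirectWalk

/-! ### Transfers along direct paths -/

theorem IsMRF.extVal {n : ℕ} {G : Type*} [DecidableEq G] {v : Fin n → Finset G → ℝ} (hv : ∀ i, IsMRF (v i)) :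
    ∀ a, IsMRF (extVal v a)
  | some i => hv i
  -- Cardinality is the rank function of the free matroid, so the dummy agent needs no separate
  -- treatment.
  | none =>
    { empty := by simp [YankeeSwap.extVal]
      marginal := fun S g => by
        by_cases hg : g ∈ S
        · left; simp [YankeeSwap.extVal, hg]
        · right; simp [YankeeSwap.extVal, hg]
      submodular := fun S T g hST => by
        by_cases hT : g ∈ T
        · by_cases hS : g ∈ S
          · simp [YankeeSwap.extVal, hT, hS]
          · simp [YankeeSwap.extVal, hT, hS]
        · have hS : g ∉ S := fun h => hT (hST h)
          simp [YankeeSwap.extVal, hT, hS] }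

@[simp]
theorem mem_bundle {n : ℕ} {G : Type*} [Fintype G] {X : Allocation n G} {a : Option (Fin n)} {g : G} :
    g ∈ bundle X a ↔ X g = a := by
  simp [bundle]

/-- `transfer` reassigns the head of the path last; reassigning it first lets an induction on the
path change the allocation one good at a time. -/
theorem transfer_cons_eq_transfer_update {n : ℕ} {G : Type*} [DecidableEq G] {g : G} (p : List G) :
    ∀ (X : Allocation n G) (a b : Option (Fin n)), g ∉ p →
      Function.update (transfer X b p) g a = transfer (Function.update X g a) b p := by
  induction p with
  | nil => intro X a b _; rfl
  | cons x p ih =>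
    intro X a b hg
    rw [List.mem_cons, not_or] at hg
    simp only [transfer]
    rw [Function.update_comm (Ne.symm hg.1), ih X a (X x) hg.2, Function.update_of_ne (Ne.symm hg.1)]

section Transfer

variable {n : ℕ} {G : Type*} [Fintype G] [DecidableEq G]

/-- An allocation all of whose bundles, including the dummy agent's, are independent. -/
def NonRedundant (v : Fin n → Finset G → ℝ) (X : Allocation n G) : Prop :=
  ∀ a, extVal v a (bundle X a) = (bundle X a).card

/-- The goods with marginal gain `1` for an agent or the dummy agent. -/
def extDesired (v : Fin n → Finset G → ℝ) (X : Allocation n G) (a : Option (Fin n)) : Set G :=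
  {g | extVal v a (insert g (bundle X a)) - extVal v a (bundle X a) = 1}

theorem bundle_update_self (X : Allocation n G) (g : G) (a : Option (Fin n)) :
    bundle (Function.update X g a) a = insert g (bundle X a) := by
  ext x
  by_cases h : x = g <;> simp [h]

theorem bundle_update_owner (X : Allocation n G) (g : G) {a : Option (Fin n)} (ha : X g ≠ a) :
    bundle (Function.update X g a) (X g) = (bundle X (X g)).erase g := by
  ext x
  by_cases h : x = g <;> simp [h, ha.symm]

theorem bundle_update_of_ne (X : Allocation n G) (g : G) {a b : Option (Fin n)} (hb : b ≠ a)
    (hb' : b ≠ X g) : bundle (Function.update X g a) b = bundle X b := by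
  ext x
  by_cases h : x = g <;> simp [h, hb.symm, hb'.symm]

variable {v : Fin n → Finset G → ℝ} {X : Allocation n G}

theorem ne_of_mem_extDesired {a : Option (Fin n)} {g : G} (hg : g ∈ extDesired v X a) :
    X g ≠ a := by
  intro h
  have : g ∈ bundle X a := mem_bundle.2 h
  simp [extDesired, this] at hg

theorem NonRedundant.update (hv : ∀ i, IsMRF (v i)) (hX : NonRedundant v X) {a : Option (Fin n)}
    {g : G} (hg : g ∈ extDesired v X a) : NonRedundant v (Function.update X g a) := by
  have hga := ne_of_mem_extDesired hg
  intro b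
  by_cases hb : b = a
  · subst hb
    have hg' : g ∉ bundle X b := by simpa using hga
    have h1 : extVal v b (insert g (bundle X b)) - extVal v b (bundle X b) = 1 := hg
    rw [bundle_update_self, Finset.card_insert_of_notMem hg']
    push_cast
    linarith [hX b]
  · by_cases hb' : b = X g
    · subst hb'
      rw [bundle_update_owner X g hga]
      exact (IsMRF.extVal hv _).eq_card_of_subset (Finset.erase_subset _ _) (hX _)
    · rw [bundle_update_of_ne X g hb hb']
      exact hX b

/-- Moving the first good of a direct path to `a` does not affect the rest of the exchange graph. -/
theorem exchangeEdge_update_iff (hv : ∀ i, IsMRF (v i)) (hX : NonRedundant v X)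
    {a : Option (Fin n)} {g x h : G} (hg : g ∈ extDesired v X a) (hx : x ≠ g)
    (ha : h ∉ extDesired v X a) (hgh : ¬ ExchangeEdge v X g h) :
    ExchangeEdge v X x h ↔ ExchangeEdge v (Function.update X g a) x h := by
  have hga := ne_of_mem_extDesired hg
  have hg1 : extVal v a (insert g (bundle X a)) - extVal v a (bundle X a) = 1 := hg
  unfold ExchangeEdge
  rw [Function.update_of_ne hx]
  have hxX : x ∈ bundle X (X x) := by simp
  have hf := IsMRF.extVal hv (X x)
  have hcard := hX (X x)
  by_cases hb : X x = a
  · rw [hb] at hxX hf hcard ⊢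
    rw [bundle_update_self, Finset.erase_insert_of_ne hx.symm, Finset.insert_comm]
    -- The bundle of `a` spans `h` but not `g`, so `g` still has marginal gain 1 after adding `h`
    -- and, by submodularity, also after erasing `x`. Both sides of the edge equation rise by one.
    have h1 : extVal v a (insert h (bundle X a)) = extVal v a (bundle X a) := by
      rcases hf.marginal (bundle X a) h with h2 | h2
      · linarith
      · exact absurd h2 ha
    have h2 := hf.insert_le (insert h ((bundle X a).erase x)) g
    have h3 := hf.submodular (insert h ((bundle X a).erase x)) (insert h (bundle X a)) g
      (Finset.insert_subset_insert _ (Finset.erase_subset _ _))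
    have h4 : extVal v a (insert g (bundle X a)) ≤
        extVal v a (insert g (insert h (bundle X a))) :=
      hf.mono (Finset.insert_subset_insert _ (Finset.subset_insert _ _))
    rcases hf.insert_erase_eq_or hcard hxX h with h5 | h5
    · exact ⟨fun _ => by linarith, fun _ => h5⟩
    · exact ⟨fun h6 => by linarith, fun h6 => by linarith⟩
  · by_cases hb' : X x = X g
    · rw [hb'] at hxX hf hcard ⊢
      rw [bundle_update_owner X g hga]
      have hgX : g ∈ bundle X (X g) := by simp
      set I := bundle X (X g) with hI
      set f := extVal v (X g) with hf'
      have h0 : f (I.erase g) = f I - 1 := by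
        have h1 := hf.eq_card_of_subset (I.erase_subset g) hcard
        have h2 : ((I.erase g).card : ℝ) + 1 = I.card := by
          exact_mod_cast Finset.card_erase_add_one hgX
        linarith
      have h1 : f (insert h (I.erase g)) = f I - 1 :=
        (hf.insert_erase_eq_or hcard hgX h).resolve_left hgh
      have h00 : f (I.erase g) = (I.erase g).card :=
        hf.eq_card_of_subset (I.erase_subset g) hcard
      have h2 := hf.insert_erase_eq_or h00 (Finset.mem_erase.2 ⟨hx, hxX⟩) h
      -- Erasing `g` lowers the rank by at most one, so an edge survives. Conversely, `h` is spanned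
      -- by `I.erase g`; if it is also spanned by `I.erase x`, it is spanned by their intersection,
      -- and no edge appears.
      rcases hf.insert_erase_eq_or hcard hxX h with h3 | h3
      · refine ⟨fun _ => ?_, fun _ => h3⟩
        have h4 := hf.submodular (insert h ((I.erase g).erase x)) (insert h (I.erase x)) g
          (Finset.insert_subset_insert _ (Finset.erase_subset_erase _ (Finset.erase_subset _ _)))
        have h5 := hf.union_le_add_card (insert h ((I.erase g).erase x)) {g}
        have h6 : f (insert h (I.erase x)) ≤ f (insert h ((I.erase g).erase x) ∪ {g}) := by
          apply hf.mono
          intro z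
          simp only [Finset.mem_insert, Finset.mem_erase, Finset.mem_union, Finset.mem_singleton]
          tauto
        simp only [Finset.card_singleton, Nat.cast_one] at h5
        rcases h2 with h2 | h2
        · exact h2
        · linarith
      · refine ⟨fun h6 => by linarith [hf.le_insert I h], fun h6 => ?_⟩
        have h4 := hf.union_add_inter_le (insert h (I.erase x)) (insert h (I.erase g))
        have h5 : f I ≤ f (insert h (I.erase x) ∪ insert h (I.erase g)) := by
          apply hf.mono
          intro z hz
          by_cases hzx : z = x
          · simp [hzx, hx, hxX]
          · simp [hz, hzx]
        have h7 : insert h (I.erase x) ∩ insert h (I.erase g) =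
            insert h ((I.erase g).erase x) := by
          ext z; simp; tauto
        rw [h7] at h4
        linarith
    · rw [bundle_update_of_ne X g hb hb']

/-- The recipient `a` is arbitrary because, once `g` is given to `a`, the former owner of `g`
becomes the recipient along the tail. The condition on the last good says that the final loser is
the dummy agent, also for the empty path. -/
theorem transfer_direct (hv : ∀ i, IsMRF (v i)) (p : List G) :
    ∀ (X : Allocation n G) (a : Option (Fin n)), NonRedundant v X →
      IsDirect (extDesired v X a) (ExchangeEdge v X) p → (p.getLast?.map X).getD a = none →
      NonRedundant v (transfer X a p) ∧ ∀ b, (bundle (transfer X a p) b).card +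
        (if b = none then 1 else 0) = (bundle X b).card + if b = a then 1 else 0 := by
  induction p with
  | nil =>
    intro X a hX _ ha
    have : a = none := by simpa using ha
    subst this
    exact ⟨hX, fun b => rfl⟩
  | cons g p ih =>
    rintro X a hX ⟨hg, hF, hE⟩ hl
    have hga := ne_of_mem_extDesired hg
    have hgp : g ∉ p := fun h => hF g h hg
    have hne : ∀ x ∈ p, x ≠ g := fun x hx h => hgp (h ▸ hx)
    have key : transfer X a (g :: p) = transfer (Function.update X g a) (X g) p :=
      transfer_cons_eq_transfer_update p X a (X g) hgp
    have hX' := hX.update hv hg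
    have hdir : IsDirect (extDesired v (Function.update X g a) (X g))
        (ExchangeEdge v (Function.update X g a)) p := by
      have hgX : g ∈ bundle X (X g) := by simp
      refine IsDirect.congr p (fun h _ => ?_) (fun x hx h hh => ?_) hE
      -- Losing `g` costs its owner exactly one, so the heads of the edges from `g` are exactly the
      -- goods which that owner now desires.
      · have h1 := (IsMRF.extVal hv (X g)).eq_card_of_subset
          ((bundle X (X g)).erase_subset g) (hX _)
        have h2 : (((bundle X (X g)).erase g).card : ℝ) + 1 = (bundle X (X g)).card := by
          exact_mod_cast Finset.card_erase_add_one hgX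
        have h3 := hX (X g)
        simp only [extDesired, Set.mem_ofPred_eq, ExchangeEdge, bundle_update_owner X g hga]
        constructor <;> intro h4 <;> linarith
      · refine exchangeEdge_update_iff hv hX hg (hne x hx) (hF h (List.mem_of_mem_tail hh)) ?_
        cases p with
        | nil => simp at hh
        | cons y p => exact hE.2.1 h hh
    have hl' : (p.getLast?.map (Function.update X g a)).getD (X g) = none := by
      cases hp : p.getLast? with
      | none =>
        have : p = [] := by simpa using hp
        subst this
        simpa using hl
      | some y =>
        have hy : y ∈ p := List.mem_of_getLast? hp
        simpa [List.getLast?_cons, hp, Function.update_of_ne (hne y hy)] using hl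
    obtain ⟨h1, h2⟩ := ih _ _ hX' hdir hl'
    rw [key]
    refine ⟨h1, fun b => ?_⟩
    rw [h2 b]
    by_cases hb : b = a
    · subst hb
      have : g ∉ bundle X b := by simpa using hga
      rw [bundle_update_self, Finset.card_insert_of_notMem this, if_neg hga.symm, if_pos rfl]
    · by_cases hb' : b = X g
      · subst hb'
        have hgX : g ∈ bundle X (X g) := by simp
        rw [bundle_update_owner X g hga, if_pos rfl, if_neg hb, Finset.card_erase_add_one hgX]
        rfl
      · rw [bundle_update_of_ne X g hb hb', if_neg hb, if_neg hb']

/-- Transfer along a shortest path keeps the allocation non-redundant, adds one good to the bundle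
of agent `i`, and preserves the sizes of the bundles of the other agents. -/
theorem IsShortestPath.transfer (hv : ∀ i, IsMRF (v i)) (hX : NonRedundant v X) {i : Fin n}
    {p : List G} (hp : IsShortestPath v X i p) :
    NonRedundant v (transfer X (some i) p) ∧ ∀ b, (bundle (transfer X (some i) p) b).card +
      (if b = none then 1 else 0) = (bundle X b).card + if b = some i then 1 else 0 := by
  have hdir : IsDirect (extDesired v X (some i)) (ExchangeEdge v X) p :=
    IsWalk.isDirect_of_minimal (T := {g | g ∈ bundle X none}) p hp.1 hp.2
  refine transfer_direct hv p X (some i) hX hdir ?_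
  obtain ⟨g, hg, hg'⟩ := hp.1.2.2
  rw [Option.mem_def] at hg
  simpa [hg] using hg'

end Transfer

/-! ### Tight sets of agents and their certificates -/

section Tight

variable {n : ℕ} {G : Type*} [Fintype G] [DecidableEq G] {v : Fin n → Finset G → ℝ}
  {X Y : Allocation n G} {A B : Finset (Fin n)} {R Q : Finset G}

/-- A certificate `R` for the fact that the agents in `A` cannot jointly get more than in `X`:
all goods of `R` are held by these agents, and their other goods span all goods outside `R`. -/
structure TightCert (v : Fin n → Finset G → ℝ) (X : Allocation n G) (A : Finset (Fin n))
    (R : Finset G) : Prop where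
  covered : ∀ h ∈ R, ∃ j ∈ A, X h = some j
  spanned : ∀ j ∈ A, v j Rᶜ ≤ ((bundle X (some j) \ R).card : ℝ)

theorem pairwiseDisjoint_bundle_inter (X : Allocation n G) (A : Finset (Fin n)) (R : Finset G) :
    (A : Set (Fin n)).PairwiseDisjoint fun j => bundle X (some j) ∩ R := by
  intro i _ j _ hij
  rw [Function.onFun, Finset.disjoint_left]
  intro x hx hx'
  simp only [Finset.mem_inter, mem_bundle] at hx hx'
  exact hij (Option.some_injective _ (hx.1.symm.trans hx'.1))

theorem sum_card_bundle_inter_le (X : Allocation n G) (A : Finset (Fin n)) (R : Finset G) :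
    ∑ j ∈ A, (bundle X (some j) ∩ R).card ≤ R.card := by
  rw [← Finset.card_biUnion]
  · exact Finset.card_le_card (Finset.biUnion_subset.2 fun _ _ => Finset.inter_subset_right)
  · exact pairwiseDisjoint_bundle_inter X A R

theorem TightCert.card_le (h : TightCert v X A R) :
    R.card ≤ ∑ j ∈ A, (bundle X (some j) ∩ R).card := by
  refine le_trans (Finset.card_le_card fun x hx => ?_) Finset.card_biUnion_le
  obtain ⟨j, hj, hxj⟩ := h.covered x hx
  simp only [Finset.mem_biUnion, Finset.mem_inter, mem_bundle]
  exact ⟨j, hj, hxj, hx⟩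

/-- The matroid-union bound for one agent: goods outside `R` contribute at most the rank of `Rᶜ`,
goods in `R` at most one each. -/
theorem utility_le_span_add (hv : ∀ i, IsMRF (v i)) (Y : Allocation n G) (R : Finset G)
    (j : Fin n) : utility v Y j ≤ v j Rᶜ + (bundle Y (some j) ∩ R).card := by
  have h1 := (hv j).union_le_add_card (bundle Y (some j) \ R) (bundle Y (some j) ∩ R)
  rw [Finset.sdiff_union_inter] at h1
  have h2 : v j (bundle Y (some j) \ R) ≤ v j Rᶜ :=
    (hv j).mono fun x hx => Finset.mem_compl.2 (Finset.mem_sdiff.1 hx).2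
  exact h1.trans (by linarith)

theorem TightCert.span_add_le (h : TightCert v X A R) {j : Fin n} (hj : j ∈ A) :
    v j Rᶜ + (bundle X (some j) ∩ R).card ≤ (bundle X (some j)).card := by
  have h1 := h.spanned j hj
  have h2 : ((bundle X (some j) \ R).card : ℝ) + (bundle X (some j) ∩ R).card =
      (bundle X (some j)).card := by
    exact_mod_cast Finset.card_sdiff_add_card_inter (bundle X (some j)) R
  linarith

theorem TightCert.sum_span_add_card_le (h : TightCert v X A R) :
    ∑ j ∈ A, v j Rᶜ + R.card ≤ ∑ j ∈ A, ((bundle X (some j)).card : ℝ) := by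
  have h1 := Finset.sum_le_sum fun j hj => h.span_add_le (j := j) hj
  rw [Finset.sum_add_distrib] at h1
  have h2 : (R.card : ℝ) ≤ ∑ j ∈ A, ((bundle X (some j) ∩ R).card : ℝ) := by
    exact_mod_cast h.card_le
  linarith

theorem TightCert.sum_utility_le (hv : ∀ i, IsMRF (v i)) (h : TightCert v X A R)
    (Y : Allocation n G) :
    ∑ j ∈ A, utility v Y j ≤ ∑ j ∈ A, ((bundle X (some j)).card : ℝ) := by
  have h1 := Finset.sum_le_sum fun j (_ : j ∈ A) => utility_le_span_add hv Y R j
  rw [Finset.sum_add_distrib] at h1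
  have h2 : ∑ j ∈ A, ((bundle Y (some j) ∩ R).card : ℝ) ≤ R.card := by
    exact_mod_cast sum_card_bundle_inter_le Y A R
  linarith [h.sum_span_add_card_le]

/-- The certificate caps the total over `A`, so no single size can have increased. -/
theorem TightCert.card_eq (hv : ∀ i, IsMRF (v i)) (h : TightCert v X A R)
    (hY : ∀ j, utility v Y j = (bundle Y (some j)).card)
    (hXY : ∀ j ∈ A, (bundle X (some j)).card ≤ (bundle Y (some j)).card) :
    ∀ j ∈ A, (bundle X (some j)).card = (bundle Y (some j)).card := by
  refine (Finset.sum_eq_sum_iff_of_le hXY).1 (le_antisymm (Finset.sum_le_sum hXY) ?_)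
  have h1 := h.sum_utility_le hv Y
  simp only [hY] at h1
  exact_mod_cast h1

/-- A certificate stays valid when the bundles of its agents do not shrink. -/
theorem TightCert.persist (hv : ∀ i, IsMRF (v i)) (h : TightCert v X A R)
    (hY : ∀ j, utility v Y j = (bundle Y (some j)).card)
    (hXY : ∀ j ∈ A, (bundle X (some j)).card ≤ (bundle Y (some j)).card) :
    TightCert v Y A R := by
  have heq := h.card_eq hv hY hXY
  have hR : ∑ j ∈ A, ((bundle Y (some j) ∩ R).card : ℝ) ≤ R.card := by
    exact_mod_cast sum_card_bundle_inter_le Y A R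
  have h1 := h.sum_span_add_card_le
  have h2 : ∀ j ∈ A, ((bundle X (some j)).card : ℝ) ≤
      v j Rᶜ + (bundle Y (some j) ∩ R).card := fun j hj => by
    rw [heq j hj, ← hY j]
    exact utility_le_span_add hv Y R j
  have h3 := Finset.sum_le_sum h2
  rw [Finset.sum_add_distrib] at h3
  -- The sum of the right sides in `h2` is squeezed between the total size of the bundles and the
  -- bound `∑ v j Rᶜ + |R|`. Equality holds everywhere: termwise it gives `spanned`, and for `R` it
  -- gives `covered`.
  have h4 : ∀ j ∈ A, ((bundle X (some j)).card : ℝ) =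
      v j Rᶜ + (bundle Y (some j) ∩ R).card :=
    (Finset.sum_eq_sum_iff_of_le h2).1 (by rw [Finset.sum_add_distrib]; linarith)
  constructor
  · have h5 : (R.card : ℝ) ≤ ∑ j ∈ A, ((bundle Y (some j) ∩ R).card : ℝ) := by linarith
    have h6 : R.card ≤ ∑ j ∈ A, (bundle Y (some j) ∩ R).card := by exact_mod_cast h5
    rw [← Finset.card_biUnion] at h6
    · have h7 := Finset.eq_of_subset_of_card_le
        (Finset.biUnion_subset.2 fun _ _ => Finset.inter_subset_right) h6
      intro x hx
      rw [← h7] at hx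
      simp only [Finset.mem_biUnion, Finset.mem_inter, mem_bundle] at hx
      obtain ⟨j, hj, hxj, _⟩ := hx
      exact ⟨j, hj, hxj⟩
    · exact pairwiseDisjoint_bundle_inter Y A R
  · intro j hj
    have h5 := h4 j hj
    have h6 : ((bundle Y (some j) \ R).card : ℝ) + (bundle Y (some j) ∩ R).card =
        (bundle Y (some j)).card := by
      exact_mod_cast Finset.card_sdiff_add_card_inter (bundle Y (some j)) R
    have h7 : ((bundle X (some j)).card : ℝ) = (bundle Y (some j)).card := by
      exact_mod_cast heq j hj
    linarith

theorem TightCert.not_mem (h : TightCert v X A R) {j : Fin n} (hj : j ∉ A) :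
    bundle X (some j) \ R = bundle X (some j) := by
  refine Finset.sdiff_eq_self_of_disjoint (Finset.disjoint_left.2 fun x hx hxR => ?_)
  obtain ⟨k, hk, hxk⟩ := h.covered x hxR
  have : k = j := Option.some_injective _ (hxk.symm.trans (mem_bundle.1 hx))
  exact hj (this ▸ hk)

/-- For `j` in both sets, uncross `Rᶜ` and `Qᶜ` by submodularity: their union contains the
independent set `bundle X (some j) \ (R ∩ Q)`, which bounds its rank from below. For `j ∉ B`, the
bundle of `j` misses `Q`. -/
theorem TightCert.spanned_union (hv : ∀ i, IsMRF (v i)) (h : TightCert v X A R)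
    (h' : TightCert v X B Q) (hX : ∀ j, utility v X j = (bundle X (some j)).card) {j : Fin n}
    (hj : j ∈ A) : v j (R ∪ Q)ᶜ ≤ ((bundle X (some j) \ (R ∪ Q)).card : ℝ) := by
  have h1 := h.spanned j hj
  by_cases hj' : j ∈ B
  · have h2 := h'.spanned j hj'
    have h3 := (hv j).union_add_inter_le Rᶜ Qᶜ
    rw [← Finset.compl_union, ← Finset.compl_inter] at h3
    have h4 : v j (bundle X (some j) \ (R ∩ Q)) ≤ v j (R ∩ Q)ᶜ :=
      (hv j).mono fun x hx => Finset.mem_compl.2 (Finset.mem_sdiff.1 hx).2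
    have h5 : v j (bundle X (some j) \ (R ∩ Q)) = (bundle X (some j) \ (R ∩ Q)).card :=
      (hv j).eq_card_of_subset Finset.sdiff_subset (hX j)
    have h6 : ((bundle X (some j) \ (R ∩ Q)).card : ℝ) + (bundle X (some j) \ (R ∪ Q)).card =
        (bundle X (some j) \ R).card + (bundle X (some j) \ Q).card := by
      rw [Finset.sdiff_inter_distrib_right, Finset.sdiff_union_distrib]
      exact_mod_cast Finset.card_union_add_card_inter _ _
    linarith
  · have h2 : bundle X (some j) \ (R ∪ Q) = bundle X (some j) \ R := by
      rw [Finset.sdiff_union_distrib, h'.not_mem hj']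
      exact Finset.inter_eq_left.2 Finset.sdiff_subset
    rw [h2]
    exact ((hv j).mono (Finset.compl_subset_compl.2 Finset.subset_union_left)).trans h1

theorem TightCert.union (hv : ∀ i, IsMRF (v i)) (h : TightCert v X A R)
    (h' : TightCert v X B Q) (hX : ∀ j, utility v X j = (bundle X (some j)).card) :
    TightCert v X (A ∪ B) (R ∪ Q) := by
  constructor
  · intro x hx
    rcases Finset.mem_union.1 hx with hx | hx
    · obtain ⟨j, hj, hxj⟩ := h.covered x hx
      exact ⟨j, Finset.mem_union_left _ hj, hxj⟩
    · obtain ⟨j, hj, hxj⟩ := h'.covered x hx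
      exact ⟨j, Finset.mem_union_right _ hj, hxj⟩
  · intro j hj
    rcases Finset.mem_union.1 hj with hj | hj
    · exact h.spanned_union hv h' hX hj
    · rw [Finset.union_comm]
      exact h'.spanned_union hv h hX hj

theorem exists_tightCert_biUnion (hv : ∀ i, IsMRF (v i))
    (hX : ∀ j, utility v X j = (bundle X (some j)).card) {F : Fin n → Finset (Fin n)}
    (hF : ∀ i, ∃ R, TightCert v X (F i) R) (T : Finset (Fin n)) :
    ∃ R, TightCert v X (T.biUnion F) R := by
  induction T using Finset.induction_on with
  | empty => exact ⟨∅, by simp, by simp⟩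
  | insert i T _ ih =>
    obtain ⟨R, hR⟩ := ih
    obtain ⟨Q, hQ⟩ := hF i
    rw [Finset.biUnion_insert]
    exact ⟨_, hQ.union hv hR hX⟩

/-- If the exchange graph has no path from the goods desired by `i` to the unallocated goods, then
some set of agents containing `i` is tight. -/
theorem exists_tightCert_of_no_path (hv : ∀ i, IsMRF (v i))
    (hX : ∀ j, utility v X j = (bundle X (some j)).card) {i : Fin n}
    (hp : ¬ ∃ p, IsPath v X i p) : ∃ A R, i ∈ A ∧ TightCert v X A R := by
  classical
  let Reach : G → Prop := fun h =>
    ∃ g ∈ desired v X i, Relation.ReflTransGen (ExchangeEdge v X) g h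
  let R : Finset G := Finset.univ.filter Reach
  let A : Finset (Fin n) :=
    Finset.univ.filter fun j => j = i ∨ ∃ h ∈ R, X h = some j
  have hR : ∀ h, h ∈ R ↔ Reach h := fun h => by simp [R]
  have hA : ∀ j, j ∈ A ↔ j = i ∨ ∃ h ∈ R, X h = some j := fun j => by simp [A]
  refine ⟨A, R, (hA i).2 (Or.inl rfl), ?_, ?_⟩
  · intro h hh
    cases hXh : X h with
    | some j => exact ⟨j, (hA j).2 (Or.inr ⟨h, hh, hXh⟩), rfl⟩
    | none =>
      obtain ⟨g, hg, hgh⟩ := (hR h).1 hh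
      obtain ⟨l, hl, hlast⟩ := List.exists_isChain_cons_of_relationReflTransGen hgh
      refine (hp ⟨g :: l, hl, by simpa using hg, h, ?_, mem_bundle.2 hXh⟩).elim
      rw [List.getLast?_eq_getLast_of_ne_nil (List.cons_ne_nil g l), hlast]
      rfl
  · intro j hj
    set I := bundle X (some j) with hI
    have hIc : v j I = I.card := hX j
    have hout : ∀ h ∉ R, ∀ x ∈ I, x ∈ R → v j (insert h (I.erase x)) ≤ v j I - 1 := by
      intro h hh x hx hxR
      refine (((hv j).insert_erase_eq_or hIc hx h).resolve_left fun h1 => hh ?_).le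
      obtain ⟨g, hg, hgx⟩ := (hR x).1 hxR
      refine (hR h).2 ⟨g, hg, hgx.tail ?_⟩
      rw [hI, mem_bundle] at hx
      simpa only [ExchangeEdge, hx, extVal] using h1
    -- For `j = i`, a good of marginal gain 1 would be desired and hence reachable. Any other `j`
    -- owns some `x ∈ R`, and a gain of 1 would create an edge from `x` to `h`.
    have hins : ∀ h ∉ R, v j (insert h I) ≤ v j I := by
      intro h hh
      rcases (hv j).marginal I h with h1 | h1
      · linarith
      · rcases (hA j).1 hj with rfl | ⟨x, hxR, hxj⟩
        · exact (hh ((hR h).2 ⟨h, h1, Relation.ReflTransGen.refl⟩)).elim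
        · have hx : x ∈ I := mem_bundle.2 hxj
          have h2 := hout h hh x hx hxR
          have h3 := (hv j).insert_le (insert h (I.erase x)) x
          rw [Finset.insert_comm, Finset.insert_erase hx] at h3
          linarith
    have h1 : v j ((I \ R) ∪ Rᶜ) ≤ v j (I \ R) := by
      refine (hv j).union_le_of_forall_insert_le fun h hh => ?_
      have hh' : h ∉ R := Finset.mem_compl.1 hh
      exact (hv j).insert_sdiff_le hIc (hins h hh') (hout h hh')
    calc v j Rᶜ ≤ v j ((I \ R) ∪ Rᶜ) := (hv j).mono Finset.subset_union_right
      _ ≤ v j (I \ R) := h1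
      _ ≤ ((I \ R).card : ℝ) := (hv j).le_card _

end Tight

/-! ### Separable concave maximization under tight sets -/

section Optimization

variable {ι : Type*}

/-- A nonnegative combination of a family whose sums over the superlevel sets of the coefficients
are nonpositive is nonpositive. -/
theorem sum_mul_nonpos_of_superlevel (s : Finset ι) (c d : ι → ℝ) (hc : ∀ i ∈ s, 0 ≤ c i)
    (h : ∀ r : ℝ, ∑ i ∈ s with r ≤ c i, d i ≤ 0) : ∑ i ∈ s, c i * d i ≤ 0 := by
  classical
  induction hk : s.card using Nat.strong_induction_on generalizing s c with
  | _ k ih =>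
    rcases s.eq_empty_or_nonempty with rfl | hs
    · simp
    obtain ⟨m, hm, hmin⟩ := s.exists_min_image c hs
    have hs0 : ∑ i ∈ s, d i ≤ 0 := by
      have := h (c m)
      rwa [Finset.filter_true_of_mem hmin] at this
    have hlt : (s.filter fun i => c m < c i).card < k := by
      rw [← hk]
      exact Finset.card_lt_card (Finset.filter_ssubset.2 ⟨m, hm, lt_irrefl _⟩)
    have h1 := ih _ hlt (s.filter fun i => c m < c i) (fun i => c i - c m)
      (fun i hi => (sub_pos.2 (Finset.mem_filter.1 hi).2).le) (fun r => ?_) rfl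
    -- Abel summation: split off the least coefficient `c m` times the full sum, and recurse on the
    -- indices of strictly larger coefficient.
    · have h2 : ∑ i ∈ s, c i * d i = ∑ i ∈ s, (c i - c m) * d i + c m * ∑ i ∈ s, d i := by
        rw [Finset.mul_sum, ← Finset.sum_add_distrib]
        exact Finset.sum_congr rfl fun i _ => by ring
      have h3 : ∑ i ∈ s, (c i - c m) * d i =
          ∑ i ∈ s.filter (fun i => c m < c i), (c i - c m) * d i := by
        refine (Finset.sum_subset (Finset.filter_subset _ _) fun i hi hi' => ?_).symm
        have : c i = c m := by
          refine le_antisymm (not_lt.1 fun hlt => hi' (Finset.mem_filter.2 ⟨hi, hlt⟩)) (hmin i hi)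
        simp [this]
      rw [h2, h3]
      have := mul_nonpos_of_nonneg_of_nonpos (hc m hm) hs0
      linarith
    · by_cases hr : 0 < r
      · refine le_of_eq_of_le (Finset.sum_congr ?_ fun _ _ => rfl) (h (r + c m))
        ext i
        simp only [Finset.mem_filter]
        constructor
        · rintro ⟨⟨h3, _⟩, h4⟩
          exact ⟨h3, by linarith⟩
        · rintro ⟨h3, h4⟩
          exact ⟨⟨h3, by linarith⟩, by linarith⟩
      -- For `r ≤ 0` the threshold is vacuous on `t`, and `t` is itself a superlevel set of `c`, at
      -- its least coefficient `c q`.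
      · set t := s.filter fun i => c m < c i with ht
        rw [Finset.filter_true_of_mem fun i hi => by
          have := (Finset.mem_filter.1 hi).2
          linarith]
        rcases t.eq_empty_or_nonempty with hte | hte
        · simp [hte]
        obtain ⟨q, hq, hqmin⟩ := t.exists_min_image c hte
        refine le_of_eq_of_le (Finset.sum_congr ?_ fun _ _ => rfl) (h (c q))
        ext i
        simp only [Finset.mem_filter]
        constructor
        · intro hi
          exact ⟨(Finset.mem_filter.1 hi).1, hqmin i hi⟩
        · rintro ⟨h3, h4⟩
          exact Finset.mem_filter.2 ⟨h3, (Finset.mem_filter.1 hq).2.trans_le h4⟩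

theorem concave_le_of_le {h : ℕ → ℝ} (hh : Antitone fun k => h (k + 1) - h k) (u d : ℕ) :
    h (u + d) ≤ h u + (h (u + 1) - h u) * d := by
  induction d with
  | zero => simp
  | succ d ih =>
    have := hh (Nat.le_add_right u d)
    simp only at this
    push_cast
    rw [← add_assoc]
    linarith

/-- The base point is `y + d + 1`: by concavity, each unit given up below it cost at least the last
increment. -/
theorem concave_le_of_lt {h : ℕ → ℝ} (hh : Antitone fun k => h (k + 1) - h k) (y d : ℕ) :
    h y ≤ h (y + d + 1) - (h (y + d + 1) - h (y + d)) * (d + 1 : ℕ) := by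
  induction d with
  | zero => simp
  | succ d ih =>
    have := hh (Nat.le_succ (y + d))
    simp only [Nat.succ_eq_add_one] at this
    push_cast at ih ⊢
    rw [← add_assoc]
    nlinarith

/-- Optimality criterion for a separable concave objective: every `i` has a set `A i ∋ i`, such
that the unions of these sets are tight at `u`, and no `j ∈ A i` has gained less by its last unit
than `i` would gain by another one. -/
theorem sum_concave_le [Fintype ι] [DecidableEq ι] (h : ι → ℕ → ℝ)
    (hanti : ∀ i, Antitone fun k => h i (k + 1) - h i k) (hmono : ∀ i, Monotone (h i))
    (u y : ι → ℕ) (A : ι → Finset ι) (hA : ∀ i, i ∈ A i)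
    (hgain : ∀ i, ∀ j ∈ A i, 0 < u j →
      h i (u i + 1) - h i (u i) ≤ h j (u j) - h j (u j - 1))
    (htight : ∀ T : Finset ι, ∑ j ∈ T.biUnion A, (y j : ℝ) ≤ ∑ j ∈ T.biUnion A, (u j : ℝ)) :
    ∑ i, h i (y i) ≤ ∑ i, h i (u i) := by
  let a : ι → ℝ := fun i => h i (u i + 1) - h i (u i)
  have ha0 : ∀ i, 0 ≤ a i := fun i => sub_nonneg.2 (hmono i (Nat.le_succ _))
  have hne : ∀ j, (Finset.univ.filter fun i => j ∈ A i).Nonempty :=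
    fun j => ⟨j, by simp [hA]⟩
  -- The number `a (m j)` is a slope of a line above `h j` touching it at `u j`: upwards because `a
  -- j ≤ a (m j)`, downwards by `hgain`.
  choose m hm hmax using fun j => Finset.exists_max_image _ a (hne j)
  simp only [Finset.mem_filter, Finset.mem_univ, true_and] at hm hmax
  have hbound : ∀ j, h j (y j) - h j (u j) ≤ a (m j) * ((y j : ℝ) - u j) := by
    intro j
    rcases le_or_gt (u j) (y j) with hle | hlt
    · obtain ⟨d, hd⟩ := Nat.exists_eq_add_of_le hle
      have h1 := concave_le_of_le (hanti j) (u j) d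
      have h2 : a j ≤ a (m j) := hmax j j (hA j)
      have h3 : a j * (d : ℝ) ≤ a (m j) * d := mul_le_mul_of_nonneg_right h2 (Nat.cast_nonneg d)
      rw [hd]
      push_cast
      simp only [add_sub_cancel_left]
      exact (sub_le_iff_le_add'.2 h1).trans h3
    · obtain ⟨d, hd⟩ := Nat.exists_eq_add_of_lt hlt
      have h1 := concave_le_of_lt (hanti j) (y j) d
      have h2 := hgain (m j) j (hm j) (by omega)
      rw [hd, Nat.add_sub_cancel] at h2
      have h3 := mul_le_mul_of_nonneg_right h2 (Nat.cast_nonneg (α := ℝ) (d + 1))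
      have h4 : (y j : ℝ) - u j = -((d + 1 : ℕ) : ℝ) := by
        rw [hd]; push_cast; ring
      rw [h4, mul_neg]
      have h5 : h j (u j) = h j (y j + d + 1) := by rw [hd]
      rw [h5]
      linarith
  have hsum := sum_mul_nonpos_of_superlevel Finset.univ (fun j => a (m j))
    (fun j => (y j : ℝ) - u j) (fun j _ => ha0 _) (fun r => ?_)
  · have h1 := Finset.sum_le_sum fun j (_ : j ∈ Finset.univ) => hbound j
    rw [Finset.sum_sub_distrib] at h1
    linarith
  -- The superlevel sets of the slopes are unions of sets `A i`, which is where `htight` applies.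
  · have h1 : (Finset.univ.filter fun j => r ≤ a (m j)) =
        (Finset.univ.filter fun i => r ≤ a i).biUnion A := by
      ext j
      simp only [Finset.mem_filter, Finset.mem_univ, true_and, Finset.mem_biUnion]
      exact ⟨fun hr => ⟨m j, hr, hm j⟩, fun ⟨i, hi, hj⟩ => hi.trans (hmax j i hj)⟩
    rw [h1, Finset.sum_sub_distrib]
    exact sub_nonpos.2 (htight _)

end Optimization

/-! ### The penalized logarithmic objective and the gain function -/

section LogObjective

/-- The logarithmic objective `w * log k`, with penalty `K` for `k = 0`. -/
noncomputable def logObjective (K w : ℝ) (k : ℕ) : ℝ :=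
  if k = 0 then -K else w * Real.log k

theorem logObjective_zero (K w : ℝ) : logObjective K w 0 = -K := if_pos rfl

theorem logObjective_pos (K w : ℝ) {k : ℕ} (hk : 0 < k) : logObjective K w k = w * Real.log k :=
  if_neg hk.ne'

theorem logObjective_one (K w : ℝ) : logObjective K w 1 = 0 := by
  simp [logObjective]

/-- The right side is the logarithm of the gain at `k`, so comparing positive-utility gains means
comparing increments. -/
theorem logObjective_succ_sub (K w : ℝ) {k : ℕ} (hk : 0 < k) :
    logObjective K w (k + 1) - logObjective K w k = w * Real.log (1 + 1 / (k : ℝ)) := by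
  have hk' : (0 : ℝ) < k := by exact_mod_cast hk
  rw [logObjective_pos K w hk, logObjective_pos K w k.succ_pos, ← mul_sub,
    ← Real.log_div (by positivity) hk'.ne']
  congr 2
  push_cast
  field_simp

theorem log_one_add_one_div_le {k l : ℕ} (hk : 0 < k) (h : k ≤ l) :
    Real.log (1 + 1 / (l : ℝ)) ≤ Real.log (1 + 1 / (k : ℝ)) := by
  have hk' : (0 : ℝ) < k := by exact_mod_cast hk
  have : (k : ℝ) ≤ l := by exact_mod_cast h
  have : (0 : ℝ) < l := hk'.trans_le this
  gcongr

theorem logObjective_succ_sub_le {K w : ℝ} (hw : 0 ≤ w) (hK : w * Real.log 2 ≤ K) {k : ℕ}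
    (hk : 0 < k) : logObjective K w (k + 1) - logObjective K w k ≤ K := by
  rw [logObjective_succ_sub K w hk]
  refine (mul_le_mul_of_nonneg_left (log_one_add_one_div_le one_pos hk) hw).trans ?_
  norm_num at hK ⊢
  exact hK

/-- The first two increments are `K` and `w * Real.log 2`, so `hK` is exactly concavity at 0. -/
theorem logObjective_antitone_sub {K w : ℝ} (hw : 0 ≤ w) (hK : w * Real.log 2 ≤ K) :
    Antitone fun k => logObjective K w (k + 1) - logObjective K w k := by
  refine antitone_nat_of_succ_le fun k => ?_
  rcases k.eq_zero_or_pos with rfl | hk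
  · rw [zero_add, logObjective_one, logObjective_zero]
    simpa [logObjective_one] using logObjective_succ_sub_le hw hK one_pos
  · rw [logObjective_succ_sub K w hk, logObjective_succ_sub K w k.succ_pos]
    exact mul_le_mul_of_nonneg_left (log_one_add_one_div_le hk k.le_succ) hw

theorem logObjective_monotone {K w : ℝ} (hw : 0 ≤ w) (hK : 0 ≤ K) :
    Monotone (logObjective K w) := by
  refine monotone_nat_of_le_succ fun k => ?_
  rcases k.eq_zero_or_pos with rfl | hk
  · rw [zero_add, logObjective_one, logObjective_zero]
    linarith
  · rw [← sub_nonneg, logObjective_succ_sub K w hk]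
    refine mul_nonneg hw (Real.log_nonneg ?_)
    have : 0 ≤ 1 / (k : ℝ) := by positivity
    linarith

end LogObjective

/-- The gain `φ` of an agent of weight `w` and utility `x`. -/
noncomputable def gainAt (M w x : ℝ) : ℝ := if 0 < x then (1 + 1 / x) ^ w else M

theorem gainAt_le_gainAt {M w x y : ℝ} (hw : 0 ≤ w) (hx : 0 ≤ x) (hxy : x ≤ y)
    (hM : 0 < y → (1 + 1 / y) ^ w ≤ M) : gainAt M w y ≤ gainAt M w x := by
  unfold gainAt
  rcases hx.eq_or_lt with rfl | hx
  · simp only [lt_irrefl, if_false]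
    split_ifs with hy
    · exact hM hy
    · exact le_rfl
  · have hy := hx.trans_le hxy
    rw [if_pos hx, if_pos hy]
    gcongr

theorem NonRedundant.utility_eq {n : ℕ} {G : Type*} [Fintype G] {v : Fin n → Finset G → ℝ}
    {X : Allocation n G} (hX : NonRedundant v X) (j : Fin n) :
    utility v X j = (bundle X (some j)).card := hX (some j)

theorem sum_logObjective_eq {n : ℕ} {G : Type*} [Fintype G] {v : Fin n → Finset G → ℝ}
    {X : Allocation n G} {x : Fin n → ℕ} (hx : ∀ i, utility v X i = x i) (w : Fin n → ℝ) (K : ℝ) :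
    ∑ i, logObjective K (w i) (x i) =
      Real.log (∏ i ∈ posAgents v X, utility v X i ^ w i) - K * (zeroAgents v X).card := by
  have hpos : ∀ i ∈ posAgents v X, 0 < utility v X i := fun i hi => (Finset.mem_filter.1 hi).2
  rw [Real.log_prod fun i hi => (Real.rpow_pos_of_pos (hpos i hi) _).ne']
  have hz : ∀ i, utility v X i = 0 ↔ ¬ 0 < utility v X i := fun i => by
    rw [hx i]; simp
  have hzero : zeroAgents v X = Finset.univ.filter fun i => ¬ 0 < utility v X i :=
    Finset.filter_congr fun i _ => hz i
  rw [← Finset.sum_filter_add_sum_filter_not Finset.univ fun i => 0 < utility v X i,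
    sub_eq_add_neg]
  congr 1
  · refine Finset.sum_congr rfl fun i hi => ?_
    have h1 : 0 < utility v X i := (Finset.mem_filter.1 hi).2
    rw [Real.log_rpow h1, hx i]
    rw [hx i] at h1
    exact logObjective_pos K (w i) (by exact_mod_cast h1)
  · rw [hzero, Finset.sum_congr rfl (g := fun _ => -K)]
    · simp [mul_comm]
    · intro i hi
      have h1 := (hz i).2 (Finset.mem_filter.1 hi).2
      rw [hx i, Nat.cast_eq_zero] at h1
      rw [h1, logObjective_zero]

/-! ### The invariant of the run, termination and optimality -/

section Invariant

variable {n : ℕ} {G : Type*} [Fintype G] [DecidableEq G] {v : Fin n → Finset G → ℝ}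
  {w : Fin n → ℝ} {M : ℝ}

/-- The last good received by `j` had at least the gain that `i` has now. -/
def LastGain (w : Fin n → ℝ) (M : ℝ) (X : Allocation n G) (j i : Fin n) : Prop :=
  0 < (bundle X (some j)).card → gainAt M (w i) (bundle X (some i)).card ≤
    gainAt M (w j) ((bundle X (some j)).card - 1)

/-- The invariant of General Yankee Swap. -/
structure Invariant (v : Fin n → Finset G → ℝ) (w : Fin n → ℝ) (M : ℝ) (s : State n G) :
    Prop where
  nonRedundant : NonRedundant v s.alloc
  active : ∀ i ∈ s.active, ∀ j, LastGain w M s.alloc j i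
  removed : ∀ i ∉ s.active, ∃ A R, i ∈ A ∧ TightCert v s.alloc A R ∧
    ∀ j ∈ A, LastGain w M s.alloc j i

theorem invariant_init (hv : ∀ i, IsMRF (v i)) : Invariant v w M (initState n G) := by
  have h0 : ∀ j : Fin n, bundle (fun _ : G => (none : Option (Fin n))) (some j) = ∅ := by
    intro j; ext; simp
  refine ⟨?_, ?_, ?_⟩
  · rintro (_ | j)
    · rfl
    · simp [initState, h0, extVal, (hv j).empty]
  · intro i _ j hj
    simp [initState, h0] at hj
  · intro i hi
    simp [initState] at hi

theorem Invariant.step (hv : ∀ i, IsMRF (v i)) (hw : ∀ i, 0 < w i)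
    (hM : ∀ (i : Fin n) (S : Finset G), 0 < v i S → (1 + 1 / v i S) ^ w i < M)
    {s s' : State n G} (hs : Invariant v w M s) (h : Step v (nashGain w M) s s') :
    Invariant v w M s' := by
  cases h with
  | augment i p hi hp =>
    obtain ⟨hnr, hcard⟩ := hp.transfer hv hs.nonRedundant
    set X := s.alloc
    set Y := transfer X (some i) p
    have hi1 : (bundle Y (some i)).card = (bundle X (some i)).card + 1 := by
      simpa using hcard (some i)
    have hj1 : ∀ j, j ≠ i → (bundle Y (some j)).card = (bundle X (some j)).card := by
      intro j hj
      simpa [hj] using hcard (some j)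
    have hle : ∀ j, (bundle X (some j)).card ≤ (bundle Y (some j)).card := by
      intro j
      by_cases hj : j = i
      · subst hj; omega
      · exact (hj1 j hj).ge
    have hgain : ∀ k, gainAt M (w k) (bundle Y (some k)).card ≤
        gainAt M (w k) (bundle X (some k)).card := by
      intro k
      refine gainAt_le_gainAt (hw k).le (Nat.cast_nonneg _) (Nat.cast_le.2 (hle k)) fun hk => ?_
      have h1 : v k (bundle Y (some k)) = (bundle Y (some k)).card := hnr (some k)
      rw [← h1] at hk ⊢
      exact (hM k _ hk).le
    refine ⟨hnr, fun k hk j hj => (hgain k).trans ?_, fun k hk => ?_⟩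
    · by_cases hji : j = i
      · subst hji
        -- The newest good of the selected agent was obtained at its gain before the step, the
        -- largest among active agents.
        have h1 := hi.1.2 k hk
        simp only [nashGain, hs.nonRedundant.utility_eq] at h1
        simp only [hi1, Nat.cast_add, Nat.cast_one, add_sub_cancel_right]
        exact h1
      · simp only [hj1 j hji] at hj ⊢
        exact hs.active k hk j hj
    · obtain ⟨A, R, hkA, hcert, hlast⟩ := hs.removed k hk
      refine ⟨A, R, hkA, hcert.persist hv hnr.utility_eq fun j _ => hle j, fun j hj hpos => ?_⟩
      -- The certificate freezes the bundle sizes of its agents, so their last gains are unchanged,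
      -- while the gain of `k` can only fall.
      have h1 := hcert.card_eq hv hnr.utility_eq (fun j _ => hle j) j hj
      refine (hgain k).trans ?_
      simp only [← h1] at hpos ⊢
      exact hlast j hj hpos
  | remove i hi hp =>
    refine ⟨hs.nonRedundant, fun k hk => hs.active k (Finset.mem_of_mem_erase hk), fun k hk => ?_⟩
    by_cases hki : k = i
    · subst hki
      obtain ⟨A, R, hkA, hcert⟩ := exists_tightCert_of_no_path hv hs.nonRedundant.utility_eq hp
      exact ⟨A, R, hkA, hcert, fun j _ => hs.active k hi.1.1 j⟩
    · exact hs.removed k fun h => hk (Finset.mem_erase.2 ⟨hki, h⟩)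

theorem Reachable.invariant (hv : ∀ i, IsMRF (v i)) (hw : ∀ i, 0 < w i)
    (hM : ∀ (i : Fin n) (S : Finset G), 0 < v i S → (1 + 1 / v i S) ^ w i < M)
    {s : State n G} (hs : Reachable v (nashGain w M) s) : Invariant v w M s := by
  induction hs with
  | refl => exact invariant_init hv
  | tail _ h ih => exact ih.step hv hw hM h

/-- Every iteration allocates a good or removes an agent. -/
theorem Step.measure_lt {β : Type*} [LinearOrder β] {φ : (Fin n → ℝ) → Fin n → β}
    (hv : ∀ i, IsMRF (v i)) {s s' : State n G} (hs : NonRedundant v s.alloc)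
    (h : Step v φ s s') :
    (bundle s'.alloc none).card + s'.active.card < (bundle s.alloc none).card + s.active.card := by
  cases h with
  | augment i p hi hp =>
    have h1 := (hp.transfer hv hs).2 none
    simp only [reduceCtorEq, if_true, if_false] at h1
    dsimp only
    omega
  | remove i hi hp =>
    have := Finset.card_erase_lt_of_mem hi.1.1
    dsimp only
    omega

theorem exists_step {β : Type*} [LinearOrder β] {φ : (Fin n → ℝ) → Fin n → β} (s : State n G)
    (hs : s.active.Nonempty) : ∃ s', Step v φ s s' := by
  classical
  obtain ⟨k, hk, hmax⟩ := s.active.exists_max_image (φ (utility v s.alloc)) hs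
  let C := s.active.filter fun k =>
    ∀ l ∈ s.active, φ (utility v s.alloc) l ≤ φ (utility v s.alloc) k
  have hC : C.Nonempty := ⟨k, Finset.mem_filter.2 ⟨hk, hmax⟩⟩
  have hi : IsSelected v φ s (C.min' hC) :=
    ⟨Finset.mem_filter.1 (C.min'_mem hC), fun j hj => C.min'_le j (Finset.mem_filter.2 hj)⟩
  by_cases hp : ∃ p, IsPath v s.alloc (C.min' hC) p
  · have hne : ∃ k, ∃ p, IsPath v s.alloc (C.min' hC) p ∧ p.length = k :=
      ⟨_, hp.choose, hp.choose_spec, rfl⟩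
    obtain ⟨p, hp1, hp2⟩ := Nat.find_spec hne
    exact ⟨_, Step.augment s _ p hi ⟨hp1, fun q hq => hp2.trans_le (Nat.find_min' hne ⟨q, hq, rfl⟩)⟩⟩
  · exact ⟨_, Step.remove s _ hi hp⟩

theorem no_infinite_run (hv : ∀ i, IsMRF (v i)) (hw : ∀ i, 0 < w i)
    (hM : ∀ (i : Fin n) (S : Finset G), 0 < v i S → (1 + 1 / v i S) ^ w i < M) :
    ¬ ∃ r : ℕ → State n G, r 0 = initState n G ∧
      ∀ k, Step v (nashGain w M) (r k) (r (k + 1)) := by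
  rintro ⟨r, h0, hr⟩
  have hreach : ∀ k, Reachable v (nashGain w M) (r k) := by
    intro k
    induction k with
    | zero => rw [h0]; exact Relation.ReflTransGen.refl
    | succ k ih => exact ih.tail (hr k)
  exact not_strictAnti_of_wellFoundedLT
    (fun k => (bundle (r k).alloc none).card + (r k).active.card)
    (strictAnti_nat_of_succ_lt fun k =>
      (hr k).measure_lt hv ((hreach k).invariant hv hw hM).nonRedundant)

/-- At the end of the algorithm, the allocation maximizes every logarithmic objective with a large
enough penalty. -/
theorem Invariant.sum_logObjective_le (hv : ∀ i, IsMRF (v i)) (hw : ∀ i, 0 < w i)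
    (hM : ∀ (i : Fin n) (S : Finset G), 0 < v i S → (1 + 1 / v i S) ^ w i < M)
    {s : State n G} (hs : Invariant v w M s) (hact : s.active = ∅) {K : ℝ}
    (hK : ∀ i, w i * Real.log 2 ≤ K) (hK0 : 0 ≤ K) (Y : Allocation n G) {y : Fin n → ℕ}
    (hy : ∀ i, utility v Y i = y i) :
    ∑ i, logObjective K (w i) (y i) ≤
      ∑ i, logObjective K (w i) (bundle s.alloc (some i)).card := by
  have hrem : ∀ i, ∃ A R, i ∈ A ∧ TightCert v s.alloc A R ∧ ∀ j ∈ A, LastGain w M s.alloc j i :=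
    fun i => hs.removed i (by simp [hact])
  choose A R hmem hcert hlast using hrem
  refine sum_concave_le (fun i => logObjective K (w i))
    (fun i => logObjective_antitone_sub (hw i).le (hK i))
    (fun i => logObjective_monotone (hw i).le hK0) _ y A hmem ?_ ?_
  · intro i j hj hpos
    have h1 := hlast i j hj hpos
    obtain ⟨m, hm⟩ := Nat.exists_eq_add_of_lt hpos
    rw [zero_add] at hm
    rw [hm, Nat.add_sub_cancel]
    rw [hm, Nat.cast_add, Nat.cast_one, add_sub_cancel_right] at h1
    -- If `m = 0`, the last increment of `j` is the penalty `K`, which dominates every increment.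
    rcases Nat.eq_zero_or_pos m with rfl | hmpos
    · rw [zero_add, logObjective_one, logObjective_zero, zero_sub, neg_neg]
      rcases Nat.eq_zero_or_pos (bundle s.alloc (some i)).card with h0 | h0
      · rw [h0, zero_add, logObjective_one, logObjective_zero, zero_sub, neg_neg]
      · exact logObjective_succ_sub_le (hw i).le (hK i) h0
    · have hmpos' : (0 : ℝ) < m := by exact_mod_cast hmpos
      rw [logObjective_succ_sub K (w j) hmpos]
      rw [gainAt, gainAt, if_pos hmpos'] at h1
      rcases Nat.eq_zero_or_pos (bundle s.alloc (some i)).card with h0 | h0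
      · rw [h0, Nat.cast_zero, if_neg (lt_irrefl _)] at h1
        -- Here `h1` says that `M` is at most the gain at `m`. An `m`-element part of the
        -- independent bundle of `j` has value `m`, so `hM` contradicts this.
        obtain ⟨S, hS, hSm⟩ := Finset.exists_subset_card_eq
          (show m ≤ (bundle s.alloc (some j)).card by omega)
        have hSv : v j S = m := by
          rw [(hv j).eq_card_of_subset hS (hs.nonRedundant (some j)), hSm]
        have h2 := hM j S (by rw [hSv]; exact hmpos')
        rw [hSv] at h2
        exact (h2.not_ge h1).elim
      · have h0' : (0 : ℝ) < (bundle s.alloc (some i)).card := by exact_mod_cast h0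
        rw [if_pos h0'] at h1
        rw [logObjective_succ_sub K (w i) h0, ← Real.log_rpow (by positivity),
          ← Real.log_rpow (by positivity)]
        exact Real.log_le_log (by positivity) h1
  · intro T
    obtain ⟨Q, hQ⟩ := exists_tightCert_biUnion hv hs.nonRedundant.utility_eq
      (fun i => ⟨R i, hcert i⟩) T
    have := hQ.sum_utility_le hv Y
    simpa only [hy] using this

theorem Invariant.isMaxWeightedNash (hv : ∀ i, IsMRF (v i)) (hw : ∀ i, 0 < w i)
    (hM : ∀ (i : Fin n) (S : Finset G), 0 < v i S → (1 + 1 / v i S) ^ w i < M)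
    {s : State n G} (hs : Invariant v w M s) (hact : s.active = ∅) :
    IsMaxWeightedNash v w s.alloc := by
  set K₀ := ∑ i, w i * Real.log 2 with hK₀
  have hlog : 0 ≤ Real.log 2 := Real.log_nonneg one_le_two
  have hterm : ∀ i, 0 ≤ w i * Real.log 2 := fun i => mul_nonneg (hw i).le hlog
  have hK₀0 : 0 ≤ K₀ := Finset.sum_nonneg fun i _ => hterm i
  have hK₀i : ∀ i, w i * Real.log 2 ≤ K₀ :=
    fun i => Finset.single_le_sum (fun i _ => hterm i) (Finset.mem_univ i)
  have key : ∀ K, K₀ ≤ K → ∀ Y : Allocation n G,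
      Real.log (∏ i ∈ posAgents v Y, utility v Y i ^ w i) - K * (zeroAgents v Y).card ≤
      Real.log (∏ i ∈ posAgents v s.alloc, utility v s.alloc i ^ w i) -
        K * (zeroAgents v s.alloc).card := by
    intro K hK Y
    choose y hy using fun i => (hv i).exists_nat (bundle Y (some i))
    rw [← sum_logObjective_eq (x := y) hy w K,
      ← sum_logObjective_eq hs.nonRedundant.utility_eq w K]
    exact hs.sum_logObjective_le hv hw hM hact (fun i => (hK₀i i).trans hK) (hK₀0.trans hK) Y hy
  have hprod : ∀ Y : Allocation n G, 0 < ∏ i ∈ posAgents v Y, utility v Y i ^ w i := fun Y =>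
    Finset.prod_pos fun i hi => Real.rpow_pos_of_pos (Finset.mem_filter.1 hi).2 _
  refine ⟨fun Y => ?_, fun Y hY => ?_⟩
  · by_contra! hlt
    set a := Real.log (∏ i ∈ posAgents v Y, utility v Y i ^ w i)
    set b := Real.log (∏ i ∈ posAgents v s.alloc, utility v s.alloc i ^ w i)
    -- One extra zero agent costs more than `b - a`, the most that the logarithms could make up for.
    have h1 := key (K₀ + |b - a| + 1) (by linarith [abs_nonneg (b - a)]) Y
    have h2 : ((zeroAgents v Y).card : ℝ) + 1 ≤ (zeroAgents v s.alloc).card := by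
      exact_mod_cast hlt
    have h3 := mul_le_mul_of_nonneg_left h2
      (show 0 ≤ K₀ + |b - a| + 1 by linarith [abs_nonneg (b - a)])
    linarith [le_abs_self (b - a)]
  · have h1 := key K₀ le_rfl Y
    rw [hY] at h1
    exact (Real.log_le_log_iff (hprod Y) (hprod _)).1 (by linarith)

end Invariant

end YankeeSwap

theorem mainTheorem4 {n : ℕ} {G : Type*} [Fintype G] [DecidableEq G]
    (v : Fin n → Finset G → ℝ) (hv : ∀ i, YankeeSwap.IsMRF (v i))
    (w : Fin n → ℝ) (hw : ∀ i, 0 < w i)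
    (M : ℝ) (hM : ∀ (i : Fin n) (S : Finset G), 0 < v i S → (1 + 1 / v i S) ^ w i < M) :
    YankeeSwap.Computes v (YankeeSwap.nashGain w M) (YankeeSwap.IsMaxWeightedNash v w) :=
  ⟨YankeeSwap.no_infinite_run hv hw hM, fun s _ => YankeeSwap.exists_step s,
    fun _ hs hact => (hs.invariant hv hw hM).isMaxWeightedNash hv hw hM hact⟩
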